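/- Let $p$ and $q$ be coprime complex polynomials of degrees $n_p$ and $n_q$ with $\max\{n_p,n_q\}\ge 2$, let $r=p/q$, and let $f(z)=r(z)-\overline{z}$ for $z\in\mathbb{C}$ with $q(z)\neq 0$. For $c\in\mathbb{C}$ put $f_c(z)=f(z)-c=r_c(z)-\overline z$ with $r_c=r-c$. A zero $z_0$ of $f_c$ (with $q(z_0)\ne0$) is called sense-preserving, sense-reversing, or singular if $|r_c'(z_0)|>1$, $|r_c'(z_0)|<1$, or $|r_c'(z_0)|=1$, respectively; $f_c$ is called regular if it has no singular zeros. Let $N_+(f_c)$ and $N_-(f_c)$ denote the numbers of distinct sense-preserving and sense-reversing zeros of $f_c$. Then for every $c\in\mathbb{C}$ such that $f_c$ is regular, $f_c$ has only finitely many zeros, and $$N_+(f_c)-N_-(f_c)=\begin{cases} n_q-1, & \text{if } n_p\le n_q,\\ n_p, & \text{if } n_p>n_q+1.\end{cases}$$ -/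

import Mathlib

open Polynomial
open scoped ComplexConjugate

namespace RationalHarmonic

/-- The rational function `r = p / q`. Its values are used only off the zeros of `q`. -/
noncomputable def r (p q : ℂ[X]) (z : ℂ) : ℂ := p.eval z / q.eval z

/-- The rational harmonic function `f(z) = r(z) - conj z`. -/
noncomputable def f (p q : ℂ[X]) (z : ℂ) : ℂ := r p q z - conj z

/-- The shifted function `f_c(z) = f(z) - c`. -/
noncomputable def fShift (p q : ℂ[X]) (c z : ℂ) : ℂ := f p q z - c

/-- The rational part of `f_c`, that is `r_c = r - c`. -/
noncomputable def rShift (p q : ℂ[X]) (c z : ℂ) : ℂ := r p q z - c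

/-- `f_c` is again a rational harmonic function, with rational part `r_c`. -/
theorem fShift_eq (p q : ℂ[X]) (c z : ℂ) : fShift p q c z = rShift p q c z - conj z := by
  unfold fShift rShift f
  ring

/-- The zeros of `f_c` in its domain, the complement of the poles (the zeros of `q`). -/
def zeros (p q : ℂ[X]) (c : ℂ) : Set ℂ :=
  {z | q.eval z ≠ 0 ∧ fShift p q c z = 0}

/-- The sense-preserving zeros of `f_c`: those with `|r_c'| > 1`. -/
def sensePreservingZeros (p q : ℂ[X]) (c : ℂ) : Set ℂ :=
  {z | z ∈ zeros p q c ∧ 1 < ‖deriv (rShift p q c) z‖}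

/-- The sense-reversing zeros of `f_c`: those with `|r_c'| < 1`. -/
def senseReversingZeros (p q : ℂ[X]) (c : ℂ) : Set ℂ :=
  {z | z ∈ zeros p q c ∧ ‖deriv (rShift p q c) z‖ < 1}

/-- The singular zeros of `f_c`: those with `|r_c'| = 1`. -/
def singularZeros (p q : ℂ[X]) (c : ℂ) : Set ℂ :=
  {z | z ∈ zeros p q c ∧ ‖deriv (rShift p q c) z‖ = 1}

/-- `f_c` is regular if it has no singular zeros. -/
def IsRegular (p q : ℂ[X]) (c : ℂ) : Prop := singularZeros p q c = ∅

/-- `N₊(f_c)`, the number of distinct sense-preserving zeros. -/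
noncomputable def Nplus (p q : ℂ[X]) (c : ℂ) : ℕ := (sensePreservingZeros p q c).ncard

/-- `N₋(f_c)`, the number of distinct sense-reversing zeros. -/
noncomputable def Nminus (p q : ℂ[X]) (c : ℂ) : ℕ := (senseReversingZeros p q c).ncard

end RationalHarmonic

/-!
Clearing denominators, the zeros of `f_c` are the zeros of the continuous function
`H(z) = P(z) - z̄ q(z)` on the whole plane, where `P = p - c q`; coprimality keeps `H` from vanishing
at the poles. So the poles disappear from the problem, and `N₊ - N₋` becomes the total winding number
of `H` about its zeros, which has to agree with the winding number at infinity. There `H` behaves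
like a multiple of `z̄ z ^ n_q` if `n_p ≤ n_q`, and of `z ^ n_p` if `n_p > n_q + 1`.

The agreement is proved without integration (`card_sub_card_eq`). Divide `H` by the product of `z - s`
over the sense-preserving zeros `s` and of `conj (z - s)` over the sense-reversing ones. Near each
zero the quotient stays in a disc that keeps away from `0`, because one of the two terms of the
real derivative `r_c' dz - dz̄` dominates, so the quotient can be changed close to the zeros into a
nonvanishing continuous function on `ℂ`. Such a function has a continuous logarithm
(`exists_log_near_infinity`). Since the quotient is also asymptotic to `κ zᵃ z̄ᵇ`, restricting to a
large circle forces `a = b` (`eq_of_monomial_eq_exp`), which is the index formula.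

Finiteness holds for every `c`: conjugating `r_c(z) = z̄` shows that each zero satisfies the polynomial
equation obtained from `z = r*(r_c(z))`, with `r*` the conjugate of `r_c`. The equation is not an
identity, since a rational function of degree at least two is not injective
(`exists_two_preimages`).
-/

namespace RationalHarmonic

open Filter Topology

/-! ### Continuous logarithms and isolated defects -/

theorem exists_continuous_log {g : ℂ → ℂ} (hg : Continuous g) (h0 : ∀ z, g z ≠ 0) :
    ∃ l : ℂ → ℂ, Continuous l ∧ ∀ z, g z = Complex.exp (l z) := by
  have huniv : IsSimplyConnected (Set.univ : Set ℂ) := by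
    rw [isSimplyConnected_iff_exists_homotopy_refl_forall_mem]
    refine ⟨isPathConnected_univ, fun x p _ => ?_⟩
    obtain ⟨F⟩ := SimplyConnectedSpace.paths_homotopic p (Path.refl x)
    exact ⟨F, fun _ => Set.mem_univ _⟩
  obtain ⟨l, hl, hlg⟩ := Complex.exists_continuousOn_eqOn_exp_comp huniv isOpen_univ
    hg.continuousOn (by simpa using h0)
  exact ⟨l, continuousOn_univ.1 hl, fun z => (hlg (Set.mem_univ z)).symm⟩

theorem mem_slitPlane_of_norm_sub_one_lt {w : ℂ} (h : ‖w - 1‖ < 1) : w ∈ Complex.slitPlane := by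
  simpa using Complex.mem_slitPlane_of_norm_lt_one h

theorem norm_div_sub_one_le {w k : ℂ} (hk : k ≠ 0) {θ : ℝ} (h : ‖w - k‖ ≤ θ * ‖k‖) :
    ‖w / k - 1‖ ≤ θ := by
  rw [div_sub_one hk, norm_div]
  exact (div_le_iff₀ (norm_pos_iff.2 hk)).2 h

/-- Near `s`, off `s` itself, `K` stays in a disc that is bounded away from `0`. -/
def AvoidsZeroNear (K : ℂ → ℂ) (s : ℂ) : Prop :=
  ∃ k : ℂ, k ≠ 0 ∧ ∃ θ : ℝ, 0 ≤ θ ∧ θ < 1 ∧ ∀ᶠ z in 𝓝[≠] s, ‖K z - k‖ ≤ θ * ‖k‖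

/-- A function can be changed near an isolated singularity near which it stays in a disc away
from `0`, so as to become continuous there without acquiring zeros. -/
theorem exists_continuousAt_modification {K : ℂ → ℂ} {s : ℂ} {S : Set ℂ} (hS : IsClosed S)
    (hsS : s ∉ S) (hK : ∀ z, z ≠ s → z ∉ S → ContinuousAt K z)
    (hK0 : ∀ z, z ≠ s → z ∉ S → K z ≠ 0) (hs : AvoidsZeroNear K s) :
    ∃ K' : ℂ → ℂ, (∀ z ∉ S, ContinuousAt K' z) ∧ (∀ z ∉ S, K' z ≠ 0) ∧
      ∃ δ : ℝ, (∀ z, δ ≤ ‖z - s‖ → K' z = K z) ∧ ∀ z ∈ S, δ < ‖z - s‖ := by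
  obtain ⟨k, hk, θ, hθ0, hθ, hev⟩ := hs
  obtain ⟨δ, hδ, hδS⟩ : ∃ δ > 0, ∀ z, ‖z - s‖ < δ → z ∉ S ∧ (z ≠ s → ‖K z - k‖ ≤ θ * ‖k‖) := by
    have h1 : ∀ᶠ z in 𝓝 s, z ∉ S ∧ (z ≠ s → ‖K z - k‖ ≤ θ * ‖k‖) :=
      Filter.Eventually.and (hS.isOpen_compl.mem_nhds hsS) (eventually_nhdsWithin_iff.1 hev)
    obtain ⟨δ, hδ, h⟩ := Metric.eventually_nhds_iff.1 h1
    exact ⟨δ, hδ, fun z hz => h (by rwa [dist_eq_norm])⟩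
  let m : ℂ → ℝ := fun z => min 1 (‖z - s‖ / (δ / 2))
  have hm : Continuous m := by fun_prop
  have hm1 : ∀ z, δ / 2 ≤ ‖z - s‖ → m z = 1 := fun z hz =>
    min_eq_left ((one_le_div (by positivity)).2 hz)
  -- `m` interpolates between the constant `k` at `s` and `K` away from `s`
  let T : ℂ → ℂ := fun z => k * Complex.exp (m z * Complex.log (K z / k))
  have hTK : ∀ z, z ≠ s → z ∉ S → δ / 2 ≤ ‖z - s‖ → T z = K z := by
    intro z hzs hzS hz
    simp only [T, hm1 z hz, Complex.ofReal_one, one_mul]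
    rw [Complex.exp_log (div_ne_zero (hK0 z hzs hzS) hk)]
    field_simp
  have hT0 : ∀ z, T z ≠ 0 := fun z => mul_ne_zero hk (Complex.exp_ne_zero _)
  have hne : ∀ z, δ / 2 ≤ ‖z - s‖ → z ≠ s := by
    rintro z hz rfl
    simp at hz
    linarith
  refine ⟨fun z => if ‖z - s‖ < δ then T z else K z, fun z hzS => ?_, fun z hzS => ?_, δ / 2,
    fun z hz => ?_, fun z hz => ?_⟩
  · by_cases hzδ : ‖z - s‖ < δ
    · have hloc : (fun z => if ‖z - s‖ < δ then T z else K z) =ᶠ[𝓝 z] T := by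
        have : ∀ᶠ w in 𝓝 z, ‖w - s‖ < δ :=
          ContinuousAt.eventually_lt (by fun_prop) continuousAt_const hzδ
        filter_upwards [this] with w hw
        simp [hw]
      refine ContinuousAt.congr ?_ hloc.symm
      refine continuousAt_const.mul (ContinuousAt.cexp ?_)
      by_cases hzs : z = s
      · subst hzs
        have hmz : m z = 0 := by simp [m]
        rw [ContinuousAt, hmz, Complex.ofReal_zero, zero_mul]
        -- the logarithm stays bounded near `s` while its coefficient `m` tends to `0`
        have hb : ∀ᶠ w in 𝓝 z, ‖(m w : ℂ) * Complex.log (K w / k)‖ ≤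
            m w * (θ ^ 2 * (1 - θ)⁻¹ / 2 + θ) := by
          filter_upwards [Metric.ball_mem_nhds z hδ] with w hw
          have hm0 : 0 ≤ m w := le_min zero_le_one (by positivity)
          rw [norm_mul, Complex.norm_real, Real.norm_of_nonneg hm0]
          by_cases hwz : w = z
          · rw [hwz, hmz]; simp
          refine mul_le_mul_of_nonneg_left ?_ hm0
          have h1 := norm_div_sub_one_le hk
            ((hδS w (by rwa [← dist_eq_norm])).2 hwz)
          have h2 := Complex.norm_log_one_add_le (z := K w / k - 1) (h1.trans_lt hθ)
          rw [add_sub_cancel] at h2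
          refine h2.trans ?_
          have : 0 < 1 - θ := by linarith
          have : 0 < 1 - ‖K w / k - 1‖ := by linarith
          gcongr
        refine squeeze_zero_norm' hb ?_
        have := (hm.tendsto z).mul_const (θ ^ 2 * (1 - θ)⁻¹ / 2 + θ)
        rwa [hmz, zero_mul] at this
      · refine ContinuousAt.mul (by fun_prop) (ContinuousAt.clog ((hK z hzs hzS).div_const k) ?_)
        exact mem_slitPlane_of_norm_sub_one_lt
          ((norm_div_sub_one_le hk ((hδS z hzδ).2 hzs)).trans_lt hθ)
    · have hzs : δ / 2 < ‖z - s‖ := by linarith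
      refine (hK z (hne z hzs.le) hzS).congr ?_
      have h1 : ∀ᶠ w in 𝓝 z, δ / 2 < ‖w - s‖ :=
        ContinuousAt.eventually_lt continuousAt_const (by fun_prop) hzs
      filter_upwards [h1, hS.isOpen_compl.mem_nhds hzS] with w hw hwS
      split_ifs
      · exact (hTK w (hne w hw.le) hwS hw.le).symm
      · rfl
  · dsimp only
    split_ifs with h
    · exact hT0 z
    · exact hK0 z (hne z (by linarith)) hzS
  · dsimp only
    split_ifs with h
    · exact hTK z (hne z hz) (hδS z h).1 hz
    · rfl
  · by_contra hcon
    exact (hδS z (by linarith)).1 hz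

/-- A nonvanishing continuous function with finitely many singularities that do not wind around `0`
has a continuous logarithm near infinity. -/
theorem exists_log_near_infinity (S : Finset ℂ) : ∀ K : ℂ → ℂ, (∀ z ∉ S, ContinuousAt K z) →
    (∀ z ∉ S, K z ≠ 0) → (∀ s ∈ S, AvoidsZeroNear K s) →
    ∃ l : ℂ → ℂ, Continuous l ∧ ∀ᶠ z in cocompact ℂ, K z = Complex.exp (l z) := by
  induction S using Finset.induction_on with
  | empty =>
    intro K hK hK0 _
    obtain ⟨l, hl, h⟩ := exists_continuous_log
      (continuous_iff_continuousAt.2 fun z => hK z (by simp)) (fun z => hK0 z (by simp))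
    exact ⟨l, hl, .of_forall h⟩
  | insert s S hs ih =>
    intro K hK hK0 hloc
    obtain ⟨K', hc, h0, δ, heq, hδ⟩ := exists_continuousAt_modification (K := K) (s := s)
      (S := (S : Set ℂ)) S.finite_toSet.isClosed (by simpa using hs)
      (fun z h1 h2 => hK z (by simp_all)) (fun z h1 h2 => hK0 z (by simp_all))
      (hloc s (Finset.mem_insert_self _ _))
    obtain ⟨l, hl, hK'⟩ := ih K' hc h0 fun t ht => by
      obtain ⟨k, hk, θ, h1, h2, h3⟩ := hloc t (Finset.mem_insert_of_mem ht)
      refine ⟨k, hk, θ, h1, h2, ?_⟩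
      have h4 : ∀ᶠ w in 𝓝[≠] t, δ < ‖w - s‖ := Filter.Eventually.filter_mono nhdsWithin_le_nhds
        (ContinuousAt.eventually_lt continuousAt_const (by fun_prop) (hδ t ht))
      filter_upwards [h3, h4] with w hw hw'
      rwa [heq w hw'.le]
    refine ⟨l, hl, ?_⟩
    have h5 : ∀ᶠ z in cocompact ℂ, δ ≤ ‖z - s‖ := by
      have : Tendsto (fun z : ℂ => ‖z - s‖) (cocompact ℂ) atTop := by
        simpa [dist_eq_norm] using tendsto_dist_right_cocompact_atTop s
      exact this.eventually_ge_atTop δ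
    filter_upwards [hK', h5] with z hz hzδ
    rw [← heq z hzδ, hz]

/-! ### Winding numbers of monomials and a counting principle -/

/-- If `z ↦ κ zᵃ z̄ᵇ` has a continuous logarithm on a circle about `0`, it winds `a - b = 0`
times. -/
theorem eq_of_monomial_eq_exp {κ : ℂ} {a b : ℤ} {R : ℝ} (hR : 0 < R) {l : ℂ → ℂ}
    (hl : ContinuousOn l (Metric.sphere 0 R))
    (h : ∀ z, ‖z‖ = R → κ * (z ^ a * conj z ^ b) = Complex.exp (l z)) : a = b := by
  let c : ℝ → ℂ := fun t => R * Complex.exp (t * Complex.I)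
  have hc : Continuous c := by fun_prop
  have hcn : ∀ t, ‖c t‖ = R := fun t => by
    simp [c, Complex.norm_exp_ofReal_mul_I, abs_of_pos hR]
  -- `exp ∘ G` is constant, so the continuous function `G` is constant
  let G : ℝ → ℂ := fun t => l (c t) - ((a - b : ℤ) : ℂ) * (t * Complex.I)
  have hG : Continuous G := by
    refine Continuous.sub ?_ (by fun_prop)
    exact hl.comp_continuous hc fun t => by simpa using hcn t
  have hexp : ∀ t, Complex.exp (G t) = κ * ((R : ℂ) ^ a * (R : ℂ) ^ b) := by
    intro t
    have hconj : conj (c t) = R * (Complex.exp (t * Complex.I))⁻¹ := by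
      simp only [c, map_mul, Complex.conj_ofReal, ← Complex.exp_conj, Complex.conj_I,
        ← Complex.exp_neg]
      ring_nf
    simp only [G]
    rw [Complex.exp_sub, ← h _ (hcn t), hconj, Complex.exp_int_mul, zpow_sub₀ (Complex.exp_ne_zero _)]
    simp only [c, mul_zpow, inv_zpow]
    have := Complex.exp_ne_zero (t * Complex.I)
    field_simp
  have hconst : G = fun _ => G 0 := by
    refine Complex.isCoveringMap_exp.eq_of_comp_eq hG continuous_const ?_ 0 rfl
    funext t
    exact Subtype.ext ((hexp t).trans (hexp 0).symm)
  have h2 := congrFun hconst (2 * Real.pi)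
  have hper : c (2 * Real.pi) = c 0 := by simp [c, Complex.exp_two_pi_mul_I]
  simp only [G, hper] at h2
  have h3 : ((a - b : ℤ) : ℂ) = 0 := by
    have h4 : ((a - b : ℤ) : ℂ) * (2 * Real.pi * Complex.I) = 0 := by
      push_cast at h2 ⊢
      linear_combination -h2
    exact (mul_eq_zero.1 h4).resolve_right Complex.two_pi_I_ne_zero
  have h5 : a - b = 0 := by exact_mod_cast h3
  linarith

theorem avoidsZeroNear_mul {u g : ℂ → ℂ} {s : ℂ} (hu : AvoidsZeroNear u s)
    (hg : ContinuousAt g s) (hg0 : g s ≠ 0) : AvoidsZeroNear (fun z => u z * g z) s := by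
  obtain ⟨α, hα, θ, hθ0, hθ, hev⟩ := hu
  refine ⟨α * g s, mul_ne_zero hα hg0, (1 + θ) / 2, by linarith, by linarith, ?_⟩
  have hη : 0 < (1 - θ) / 4 * ‖g s‖ := mul_pos (by linarith) (norm_pos_iff.2 hg0)
  have h1 : ∀ᶠ z in 𝓝[≠] s, ‖g z - g s‖ < (1 - θ) / 4 * ‖g s‖ := by
    refine Filter.Eventually.filter_mono nhdsWithin_le_nhds ?_
    simpa [dist_eq_norm] using Metric.tendsto_nhds.1 hg _ hη
  filter_upwards [hev, h1] with z hz hgz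
  have hgn : ‖g z‖ ≤ ‖g s‖ + (1 - θ) / 4 * ‖g s‖ := by
    have := norm_add_le (g z - g s) (g s)
    rw [sub_add_cancel] at this
    linarith
  calc ‖u z * g z - α * g s‖ = ‖(u z - α) * g z + α * (g z - g s)‖ := by ring_nf
    _ ≤ ‖u z - α‖ * ‖g z‖ + ‖α‖ * ‖g z - g s‖ := by
      rw [← norm_mul, ← norm_mul]; exact norm_add_le _ _
    _ ≤ θ * ‖α‖ * (‖g s‖ + (1 - θ) / 4 * ‖g s‖) + ‖α‖ * ((1 - θ) / 4 * ‖g s‖) := by gcongr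
    _ = (θ + (1 + θ) * (1 - θ) / 4) * (‖α‖ * ‖g s‖) := by ring
    _ ≤ (1 + θ) / 2 * (‖α‖ * ‖g s‖) := by
      refine mul_le_mul_of_nonneg_right ?_ (by positivity)
      nlinarith
    _ = (1 + θ) / 2 * ‖α * g s‖ := by rw [norm_mul]

theorem eventually_ne_zero_cocompact : ∀ᶠ z : ℂ in cocompact ℂ, z ≠ 0 :=
  (isCompact_singleton (x := (0 : ℂ))).compl_mem_cocompact

theorem tendsto_prod_sub_div_pow (S : Finset ℂ) :
    Tendsto (fun z : ℂ => (∏ s ∈ S, (z - s)) / z ^ S.card) (cocompact ℂ) (𝓝 1) := by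
  have h : ∀ s ∈ S, Tendsto (fun z : ℂ => (z - s) / z) (cocompact ℂ) (𝓝 1) := by
    intro s _
    have h1 : Tendsto (fun z : ℂ => 1 - s * z⁻¹) (cocompact ℂ) (𝓝 (1 - s * 0)) :=
      tendsto_const_nhds.sub (tendsto_const_nhds.mul 
        (tendsto_inv₀_cobounded.mono_left Metric.cobounded_eq_cocompact.ge))
    rw [mul_zero, sub_zero] at h1
    refine h1.congr' ?_
    filter_upwards [eventually_ne_zero_cocompact] with z hz
    field_simp
  have := tendsto_finsetProd S h
  simpa [Finset.prod_div_distrib] using this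

/-- An argument principle: a continuous function on the plane whose zeros are, to leading order,
orientation preserving (at `P`) or orientation reversing (at `N`), and which is asymptotic to
`κ zᵐ z̄ⁿ` at infinity, satisfies `#P - #N = m - n`. -/
theorem card_sub_card_eq {H : ℂ → ℂ} (hH : Continuous H) {P N : Finset ℂ} (hPN : Disjoint P N)
    (h0 : ∀ z, z ∉ P → z ∉ N → H z ≠ 0)
    (hP : ∀ s ∈ P, AvoidsZeroNear (fun z => H z / (z - s)) s)
    (hN : ∀ s ∈ N, AvoidsZeroNear (fun z => H z / conj (z - s)) s)
    {m n : ℕ} {κ : ℂ} (hκ : κ ≠ 0)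
    (hinf : Tendsto (fun z => H z / (z ^ m * conj z ^ n)) (cocompact ℂ) (𝓝 κ)) :
    (P.card : ℤ) - N.card = m - n := by
  let A : ℂ → ℂ := fun z => ∏ s ∈ P, (z - s)
  let B : ℂ → ℂ := fun z => ∏ s ∈ N, (z - s)
  have hA : Continuous A := by fun_prop
  have hB : Continuous B := by fun_prop
  have hA0 : ∀ z, z ∉ P → A z ≠ 0 := fun z hz => Finset.prod_ne_zero_iff.2 fun s hs =>
    sub_ne_zero.2 fun h => hz (h ▸ hs)
  have hB0 : ∀ z, z ∉ N → conj (B z) ≠ 0 := fun z hz => (_root_.map_ne_zero _).2 <|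
    Finset.prod_ne_zero_iff.2 fun s hs => sub_ne_zero.2 fun h => hz (h ▸ hs)
  have hBc : Continuous fun z => conj (B z) := Complex.continuous_conj.comp hB
  let K : ℂ → ℂ := fun z => H z / (A z * conj (B z))
  have hKc : ∀ z ∉ P ∪ N, ContinuousAt K z := fun z hz => by
    rw [Finset.notMem_union] at hz
    exact hH.continuousAt.div (hA.mul hBc).continuousAt (mul_ne_zero (hA0 z hz.1) (hB0 z hz.2))
  have hK0 : ∀ z ∉ P ∪ N, K z ≠ 0 := fun z hz => by
    rw [Finset.notMem_union] at hz
    exact div_ne_zero (h0 z hz.1 hz.2) (mul_ne_zero (hA0 z hz.1) (hB0 z hz.2))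
  have hKloc : ∀ s ∈ P ∪ N, AvoidsZeroNear K s := by
    intro s hs
    rcases Finset.mem_union.1 hs with hs | hs
    · have hsN : s ∉ N := Finset.disjoint_left.1 hPN hs
      let A' : ℂ → ℂ := fun z => ∏ t ∈ P.erase s, (z - t)
      have hA' : A' s ≠ 0 := Finset.prod_ne_zero_iff.2 fun t ht =>
        sub_ne_zero.2 (Finset.ne_of_mem_erase ht).symm
      have hA'c : Continuous A' := by fun_prop
      have := avoidsZeroNear_mul (hP s hs) (g := fun z => (A' z * conj (B z))⁻¹)
        ((hA'c.mul hBc).continuousAt.inv₀ (mul_ne_zero hA' (hB0 s hsN)))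
        (inv_ne_zero (mul_ne_zero hA' (hB0 s hsN)))
      convert this using 2 with z
      simp only [K, A, A', ← Finset.mul_prod_erase P _ hs]
      rw [← div_eq_mul_inv, div_div, mul_assoc]
    · have hsP : s ∉ P := Finset.disjoint_right.1 hPN hs
      let B' : ℂ → ℂ := fun z => ∏ t ∈ N.erase s, (z - t)
      have hB' : conj (B' s) ≠ 0 := (_root_.map_ne_zero _).2 <| Finset.prod_ne_zero_iff.2 fun t ht =>
        sub_ne_zero.2 (Finset.ne_of_mem_erase ht).symm
      have hB'c : Continuous fun z => conj (B' z) :=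
        Complex.continuous_conj.comp (by fun_prop)
      have := avoidsZeroNear_mul (hN s hs) (g := fun z => (A z * conj (B' z))⁻¹)
        ((hA.mul hB'c).continuousAt.inv₀ (mul_ne_zero (hA0 s hsP) hB'))
        (inv_ne_zero (mul_ne_zero (hA0 s hsP) hB'))
      convert this using 2 with z
      simp only [K, B, B', ← Finset.mul_prod_erase N _ hs, map_mul]
      rw [← div_eq_mul_inv, div_div, mul_left_comm]
  obtain ⟨l, hl, hlK⟩ := exists_log_near_infinity (P ∪ N) K hKc hK0 hKloc
  -- `U` compares `K` with the monomial expected at infinity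
  let a : ℤ := m - P.card
  let b : ℤ := n - N.card
  let U : ℂ → ℂ := fun z => K z / (z ^ a * conj z ^ b)
  have hz0 : ∀ᶠ z : ℂ in cocompact ℂ, z ≠ 0 := eventually_ne_zero_cocompact
  have hU : Tendsto U (cocompact ℂ) (𝓝 κ) := by
    have h1 := tendsto_prod_sub_div_pow P
    have h2 := (Complex.continuous_conj.tendsto _).comp (tendsto_prod_sub_div_pow N)
    have h3 := hinf.div (h1.mul h2) (by simp)
    simp only [map_one, mul_one, div_one] at h3
    refine h3.congr' ?_
    filter_upwards [hz0] with z hz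
    have hcz : conj z ≠ 0 := (_root_.map_ne_zero _).2 hz
    simp only [U, K, A, B, a, b, Function.comp, Pi.div_apply, map_div₀, map_pow, zpow_sub₀ hz,
      zpow_sub₀ hcz, zpow_natCast]
    simp only [div_eq_mul_inv, mul_inv, inv_inv]
    ring
  have hUκ : ∀ᶠ z in cocompact ℂ, ‖U z / κ - 1‖ < 1 := by
    have h1 := hU.div_const κ
    rw [div_self hκ] at h1
    simpa only [dist_eq_norm] using Metric.tendsto_nhds.1 h1 1 one_pos
  have hout : ∀ᶠ z in cocompact ℂ, z ∉ P ∪ N := (P ∪ N).finite_toSet.isCompact.compl_mem_cocompact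
  obtain ⟨R, hR⟩ : ∃ R : ℝ, ∀ z : ℂ, R ≤ ‖z‖ →
      z ≠ 0 ∧ K z = Complex.exp (l z) ∧ ‖U z / κ - 1‖ < 1 ∧ z ∉ P ∪ N := by
    have h1 := hz0.and (hlK.and (hUκ.and hout))
    rw [← Metric.cobounded_eq_cocompact, ← comap_norm_atTop, eventually_comap] at h1
    obtain ⟨R, hR⟩ := eventually_atTop.1 h1
    exact ⟨R, fun z hz => hR _ hz z rfl⟩
  have hab : a = b := by
    refine eq_of_monomial_eq_exp (κ := κ) (R := max R 1) (by positivity)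
      (l := fun z => l z - Complex.log (U z / κ)) ?_ ?_
    · intro z hz
      have hz' : ‖z‖ = max R 1 := by simpa using hz
      obtain ⟨h1, -, h3, h4⟩ := hR z (hz' ▸ le_max_left _ _)
      have hcz : conj z ≠ 0 := (_root_.map_ne_zero _).2 h1
      have hUc : ContinuousAt U z := (hKc z h4).div
        ((continuousAt_zpow₀ z a (.inl h1)).mul
          ((continuousAt_zpow₀ _ b (.inl hcz)).comp Complex.continuous_conj.continuousAt))
        (mul_ne_zero (zpow_ne_zero _ h1) (zpow_ne_zero _ hcz))
      exact (hl.continuousAt.sub ((hUc.div_const κ).clog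
        (mem_slitPlane_of_norm_sub_one_lt h3))).continuousWithinAt
    · intro z hz
      obtain ⟨h1, h2, -, h4⟩ := hR z (hz ▸ le_max_left _ _)
      have hcz : conj z ≠ 0 := (_root_.map_ne_zero _).2 h1
      have hm0 : z ^ a * conj z ^ b ≠ 0 := mul_ne_zero (zpow_ne_zero _ h1) (zpow_ne_zero _ hcz)
      have hKz := hK0 z h4
      rw [Complex.exp_sub, ← h2, Complex.exp_log (div_ne_zero (div_ne_zero hKz hm0) hκ)]
      field_simp
  simp only [a, b] at hab
  linarith

/-! ### Finiteness of the zero set -/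

/-- Coprime polynomials, not both of degree at most one, define a rational function that takes some
value `w` twice, and `w` can be taken off any given finite set. -/
theorem exists_two_preimages {P Q : ℂ[X]} (hPQ : IsCoprime P Q)
    (hn : 2 ≤ max P.natDegree Q.natDegree) {T : Set ℂ} (hT : T.Finite) :
    ∃ w ∉ T, ∃ z₁ z₂ : ℂ, z₁ ≠ z₂ ∧ (P.eval z₁ = w * Q.eval z₁ ∧ Q.eval z₁ ≠ 0) ∧
      P.eval z₂ = w * Q.eval z₂ ∧ Q.eval z₂ ≠ 0 := by
  set d := max P.natDegree Q.natDegree with hd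
  have hW : wronskian P Q ≠ 0 := by
    intro h
    obtain ⟨h1, h2⟩ := hPQ.wronskian_eq_zero_iff.1 h
    have h1 := derivative_eq_zero.1 h1
    have h2 := derivative_eq_zero.1 h2
    omega
  -- avoid the critical values, and the value of the rational function at infinity
  obtain ⟨w, hw⟩ := ((hT.union ((finite_setOfPred_isRoot hW).image
    fun z => P.eval z / Q.eval z)).union
    (Set.finite_singleton (P.coeff d / Q.coeff d))).infinite_compl.nonempty
  simp only [Set.mem_compl_iff, Set.mem_union, not_or, Set.mem_singleton_iff] at hw
  obtain ⟨⟨hwT, hwW⟩, hwd⟩ := hw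
  have hcoeff : (P - C w * Q).coeff d ≠ 0 := by
    rw [coeff_sub, coeff_C_mul]
    intro h
    by_cases hQd : Q.coeff d = 0
    · have hPd : P.coeff d = 0 := by simpa [hQd] using h
      rcases max_cases P.natDegree Q.natDegree with ⟨h1, -⟩ | ⟨h1, -⟩
      · have : P = 0 := by rw [hd, h1] at hPd; simpa using hPd
        have : P.natDegree = 0 := by rw [this, natDegree_zero]
        omega
      · have : Q = 0 := by rw [hd, h1] at hQd; simpa using hQd
        have : Q.natDegree = 0 := by rw [this, natDegree_zero]
        omega
    · exact hwd (by rw [eq_div_iff hQd]; linear_combination -h)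
  have hne : P - C w * Q ≠ 0 := fun h => hcoeff (by rw [h, coeff_zero])
  have hroot : ∀ z ∈ (P - C w * Q).roots, P.eval z = w * Q.eval z ∧ Q.eval z ≠ 0 := by
    intro z hz
    have h1 : P.eval z = w * Q.eval z := by
      have := (mem_roots hne).1 hz
      rw [IsRoot, eval_sub, eval_mul, eval_C] at this
      exact sub_eq_zero.1 this
    refine ⟨h1, fun h2 => ?_⟩
    obtain ⟨u, v, huv⟩ := hPQ
    have := congrArg (eval z) huv
    simp [h1, h2] at this
  -- a multiple root `z` would be a zero of the Wronskian with `w` its critical value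
  have hnodup : (P - C w * Q).roots.Nodup := by
    rw [Multiset.nodup_iff_count_le_one]
    intro z
    rw [count_roots]
    by_contra! hcon
    have hz : z ∈ (P - C w * Q).roots := by
      rw [← Multiset.count_pos, count_roots]; omega
    obtain ⟨h1, h2⟩ := hroot z hz
    have h3 := ((one_lt_rootMultiplicity_iff_isRoot hne).1 hcon).2
    simp only [IsRoot, derivative_sub, derivative_mul, derivative_C, zero_mul, zero_add, eval_sub,
      eval_mul, eval_C] at h3
    refine hwW ⟨z, ?_, (div_eq_iff h2).2 h1⟩
    simp only [Set.mem_ofPred_eq, IsRoot, wronskian, eval_sub, eval_mul]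
    linear_combination (derivative Q).eval z * h1 - Q.eval z * h3
  have hcard : 1 < (P - C w * Q).roots.toFinset.card := by
    rw [Multiset.toFinset_card_of_nodup hnodup,
      ← (IsAlgClosed.splits (P - C w * Q)).natDegree_eq_card_roots]
    have := le_natDegree_of_ne_zero hcoeff
    omega
  obtain ⟨z₁, h1, z₂, h2, h12⟩ := Finset.one_lt_card.1 hcard
  exact ⟨w, hwT, z₁, z₂, h12, hroot _ (Multiset.mem_toFinset.1 h1),
    hroot _ (Multiset.mem_toFinset.1 h2)⟩

/-- The polynomial `Qᵈ · A*(P / Q)`, where `A*` has the conjugate coefficients of `A` and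
`A.natDegree ≤ d`. -/
noncomputable def conjComp (P Q : ℂ[X]) (d : ℕ) (A : ℂ[X]) : ℂ[X] :=
  ∑ i ∈ Finset.range (d + 1), C (conj (A.coeff i)) * P ^ i * Q ^ (d - i)

theorem eval_conjComp {P Q A : ℂ[X]} {d : ℕ} (hA : A.natDegree ≤ d) {z w : ℂ}
    (hw : P.eval z = w * Q.eval z) :
    (conjComp P Q d A).eval z = Q.eval z ^ d * conj (A.eval (conj w)) := by
  rw [conjComp, eval_finsetSum, eval_eq_sum_range' (Nat.lt_succ_of_le hA), map_sum, Finset.mul_sum]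
  refine Finset.sum_congr rfl fun i hi => ?_
  have hid : i ≤ d := Nat.lt_succ_iff.1 (Finset.mem_range.1 hi)
  simp only [eval_mul, eval_C, eval_pow, hw, map_mul, map_pow, Complex.conj_conj]
  rw [← pow_mul_pow_sub (Q.eval z) hid]
  ring

/-- A rational function of degree at least two agrees with complex conjugation at finitely many
points only: conjugating the equation gives `z = r*(r(z))`, which is not an identity because `r` is
not injective. -/
theorem finite_eval_eq_conj_mul {P Q : ℂ[X]} (hPQ : IsCoprime P Q)
    (hn : 2 ≤ max P.natDegree Q.natDegree) :
    {z : ℂ | P.eval z = conj z * Q.eval z}.Finite := by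
  set d := max P.natDegree Q.natDegree with hd
  let G : ℂ[X] := conjComp P Q d P - X * conjComp P Q d Q
  have hG : ∀ z w : ℂ, P.eval z = w * Q.eval z → G.eval z =
      Q.eval z ^ d * (conj (P.eval (conj w)) - z * conj (Q.eval (conj w))) := fun z w h => by
    simp only [G, eval_sub, eval_mul, eval_X]
    rw [eval_conjComp (hd ▸ le_max_left _ _) h, eval_conjComp (hd ▸ le_max_right _ _) h]
    ring
  have hQ0 : Q ≠ 0 := by
    rintro rfl
    have := natDegree_eq_zero_of_isUnit (isCoprime_zero_right.1 hPQ)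
    rw [natDegree_zero] at hd
    omega
  have hG0 : G ≠ 0 := by
    intro h0
    obtain ⟨w, hwT, z₁, z₂, h12, ⟨h1, h1'⟩, h2, h2'⟩ := exists_two_preimages hPQ hn
      (T := (fun z => conj z) '' {z | Q.IsRoot z}) ((finite_setOfPred_isRoot hQ0).image _)
    have hw : conj (Q.eval (conj w)) ≠ 0 := fun h =>
      hwT ⟨conj w, (_root_.map_eq_zero _).1 h, Complex.conj_conj w⟩
    have e1 := hG z₁ w h1
    have e2 := hG z₂ w h2
    rw [h0, eval_zero, eq_comm, mul_eq_zero] at e1 e2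
    have e1 := e1.resolve_left (pow_ne_zero _ h1')
    have e2 := e2.resolve_left (pow_ne_zero _ h2')
    exact h12 (mul_right_cancel₀ hw (by linear_combination e2 - e1))
  refine (finite_setOfPred_isRoot hG0).subset fun z hz => ?_
  have hz : P.eval z = conj z * Q.eval z := hz
  rw [Set.mem_ofPred_eq, IsRoot, hG z _ hz, Complex.conj_conj, hz]
  simp

/-! ### Behaviour at the zeros and at infinity -/

/-- Where `|g'| > 1`, the difference `g - z̄` is a complex multiple of `z - s` to leading order. -/
theorem avoidsZeroNear_sub_conj_div {g : ℂ → ℂ} {s α : ℂ} (hg : HasDerivAt g α s)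
    (hs : g s = conj s) (hα : 1 < ‖α‖) :
    AvoidsZeroNear (fun z => (g z - conj z) / (z - s)) s := by
  have hα0 : 0 < ‖α‖ := by linarith
  refine ⟨α, norm_pos_iff.1 hα0, (1 + ‖α‖) / (2 * ‖α‖), by positivity, ?_, ?_⟩
  · rw [div_lt_one (by positivity)]; linarith
  have h1 := Metric.tendsto_nhds.1 (hasDerivAt_iff_tendsto_slope.1 hg) ((‖α‖ - 1) / 2)
    (by linarith)
  filter_upwards [h1, self_mem_nhdsWithin] with z hz hzs
  have hzs : z - s ≠ 0 := sub_ne_zero.2 hzs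
  rw [dist_eq_norm] at hz
  have h2 : (g z - conj z) / (z - s) - α = (slope g s z - α) - conj (z - s) / (z - s) := by
    simp only [slope_def_field, hs, map_sub]
    field_simp
    ring
  have h3 : ‖conj (z - s) / (z - s)‖ = 1 := by
    rw [norm_div, Complex.norm_conj, div_self (norm_ne_zero_iff.2 hzs)]
  calc ‖(g z - conj z) / (z - s) - α‖ ≤ ‖slope g s z - α‖ + 1 := by
        rw [h2, ← h3]; exact norm_sub_le _ _
    _ ≤ (‖α‖ - 1) / 2 + 1 := by gcongr
    _ = (1 + ‖α‖) / (2 * ‖α‖) * ‖α‖ := by field_simp; ring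

/-- Where `|g'| < 1`, the difference `g - z̄` is `-conj (z - s)` to leading order. -/
theorem avoidsZeroNear_sub_conj_div_conj {g : ℂ → ℂ} {s α : ℂ} (hg : HasDerivAt g α s)
    (hs : g s = conj s) (hα : ‖α‖ < 1) :
    AvoidsZeroNear (fun z => (g z - conj z) / conj (z - s)) s := by
  refine ⟨-1, by simp, (1 + ‖α‖) / 2, by positivity, by linarith, ?_⟩
  have h1 : ∀ᶠ z in 𝓝[≠] s, ‖slope g s z‖ < (1 + ‖α‖) / 2 :=
    (hasDerivAt_iff_tendsto_slope.1 hg).norm.eventually_lt_const (by linarith)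
  filter_upwards [h1, self_mem_nhdsWithin] with z hz hzs
  have hzs : z - s ≠ 0 := sub_ne_zero.2 hzs
  have hczs : conj (z - s) ≠ 0 := (_root_.map_ne_zero _).2 hzs
  have h2 : (g z - conj z) / conj (z - s) - -1 = slope g s z * ((z - s) / conj (z - s)) := by
    rw [slope_def_field, hs, div_mul_div_cancel₀ hzs, sub_neg_eq_add, div_add_one hczs, map_sub]
    ring
  rw [h2, norm_mul, norm_div, Complex.norm_conj, div_self (norm_ne_zero_iff.2 hzs), mul_one,
    norm_neg, norm_one, mul_one]
  exact hz.le

theorem tendsto_eval_div_pow {P : ℂ[X]} {n : ℕ} (h : P.natDegree ≤ n) :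
    Tendsto (fun z => P.eval z / z ^ n) (cocompact ℂ) (𝓝 (P.coeff n)) := by
  have h1 : Tendsto (fun z : ℂ => ∑ i ∈ Finset.range (n + 1), P.coeff i * z⁻¹ ^ (n - i))
      (cocompact ℂ) (𝓝 (∑ i ∈ Finset.range (n + 1), P.coeff i * 0 ^ (n - i))) :=
    tendsto_finsetSum _ fun i _ => tendsto_const_nhds.mul
      ((tendsto_inv₀_cobounded.mono_left Metric.cobounded_eq_cocompact.ge).pow _)
  have h2 : ∑ i ∈ Finset.range (n + 1), P.coeff i * 0 ^ (n - i) = P.coeff n := by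
    rw [Finset.sum_range_succ, Finset.sum_eq_zero, zero_add, Nat.sub_self, pow_zero, mul_one]
    intro i hi
    have := Finset.mem_range.1 hi
    rw [zero_pow (by omega), mul_zero]
  rw [h2] at h1
  refine h1.congr' ?_
  filter_upwards [eventually_ne_zero_cocompact] with z hz
  rw [eval_eq_sum_range' (Nat.lt_succ_of_le h), Finset.sum_div]
  refine Finset.sum_congr rfl fun i hi => ?_
  have hin : i ≤ n := Nat.lt_succ_iff.1 (Finset.mem_range.1 hi)
  rw [inv_pow, mul_div_assoc, pow_sub₀ z hz hin]
  field_simp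

/-- At infinity the antiholomorphic term dominates. -/
theorem tendsto_numerator_of_natDegree_le {P Q : ℂ[X]} (h : P.natDegree ≤ Q.natDegree) :
    Tendsto (fun z => (P.eval z - conj z * Q.eval z) / (z ^ Q.natDegree * conj z ^ 1))
      (cocompact ℂ) (𝓝 (-Q.leadingCoeff)) := by
  have h1 : Tendsto (fun z : ℂ => (conj z)⁻¹) (cocompact ℂ) (𝓝 0) := by
    have := (Complex.continuous_conj.tendsto _).comp
      ((tendsto_inv₀_cobounded (α := ℂ)).mono_left Metric.cobounded_eq_cocompact.ge)
    simpa [Function.comp_def] using this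
  have h2 := ((tendsto_eval_div_pow h).mul h1).sub (tendsto_eval_div_pow (le_refl Q.natDegree))
  rw [mul_zero, zero_sub] at h2
  refine h2.congr' ?_
  filter_upwards [eventually_ne_zero_cocompact] with z hz
  have hcz : conj z ≠ 0 := (_root_.map_ne_zero _).2 hz
  field_simp

/-- At infinity the leading term of `P` dominates. -/
theorem tendsto_numerator_of_lt_natDegree {P Q : ℂ[X]} (h : Q.natDegree + 1 < P.natDegree) :
    Tendsto (fun z => (P.eval z - conj z * Q.eval z) / (z ^ P.natDegree * conj z ^ 0))
      (cocompact ℂ) (𝓝 P.leadingCoeff) := by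
  have h1 := tendsto_eval_div_pow (P := Q) (n := P.natDegree - 1) (by omega)
  rw [coeff_eq_zero_of_natDegree_lt (by omega)] at h1
  have h2 : Tendsto (fun z : ℂ => conj z / z * (Q.eval z / z ^ (P.natDegree - 1)))
      (cocompact ℂ) (𝓝 0) := by
    refine squeeze_zero_norm (fun z => ?_) (tendsto_zero_iff_norm_tendsto_zero.1 h1)
    rw [norm_mul]
    refine mul_le_of_le_one_left (norm_nonneg _) ?_
    rw [norm_div, Complex.norm_conj]
    exact div_self_le_one _
  have h3 := (tendsto_eval_div_pow (le_refl P.natDegree)).sub h2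
  rw [sub_zero] at h3
  refine h3.congr' ?_
  filter_upwards [eventually_ne_zero_cocompact] with z hz
  have : z ^ P.natDegree = z * z ^ (P.natDegree - 1) := by
    rw [← pow_succ', Nat.sub_add_cancel (by omega)]
  rw [this, pow_zero, mul_one, div_mul_div_comm, sub_div]

/-! ### The index formula -/

theorem AvoidsZeroNear.congr {K K' : ℂ → ℂ} {s : ℂ} (h : AvoidsZeroNear K s)
    (hK : K =ᶠ[𝓝[≠] s] K') : AvoidsZeroNear K' s := by
  obtain ⟨k, hk, θ, h1, h2, h3⟩ := h
  refine ⟨k, hk, θ, h1, h2, ?_⟩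
  filter_upwards [h3, hK] with z hz hzK
  rwa [← hzK]

/-- Off the poles, the numerator of `f_c` is `f_c` times the denominator. -/
theorem eval_sub_conj_mul_eq {p q : ℂ[X]} {c z : ℂ} (hz : q.eval z ≠ 0) :
    (p - C c * q).eval z - conj z * q.eval z = (rShift p q c z - conj z) * q.eval z := by
  simp only [rShift, r, eval_sub, eval_mul, eval_C]
  field_simp

/-- Clearing denominators loses no information: by coprimality the numerator does not vanish at the
poles. -/
theorem mem_zeros_iff {p q : ℂ[X]} (hpq : IsCoprime p q) {c z : ℂ} :
    z ∈ zeros p q c ↔ (p - C c * q).eval z = conj z * q.eval z := by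
  by_cases hz : q.eval z = 0
  · obtain ⟨u, v, huv⟩ := hpq
    have h1 := congrArg (eval z) huv
    simp only [zeros, Set.mem_ofPred_eq, hz, ne_eq, not_true_eq_false, false_and, eval_sub, eval_mul,
      eval_C, mul_zero, sub_zero, false_iff]
    intro h2
    simp [hz, h2] at h1
  · rw [zeros, Set.mem_ofPred_eq, fShift_eq, ← sub_eq_zero (b := conj z * q.eval z),
      eval_sub_conj_mul_eq hz, mul_eq_zero, or_iff_left hz, and_iff_right hz]

theorem hasDerivAt_rShift {p q : ℂ[X]} {c z : ℂ} (hz : q.eval z ≠ 0) :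
    HasDerivAt (rShift p q c) (deriv (rShift p q c) z) z := by
  refine DifferentiableAt.hasDerivAt ?_
  exact (p.differentiable.differentiableAt.div q.differentiable.differentiableAt hz).sub_const c

theorem rShift_eq_conj {p q : ℂ[X]} {c z : ℂ} (hz : z ∈ zeros p q c) :
    rShift p q c z = conj z := by
  have := hz.2
  rwa [fShift_eq, sub_eq_zero] at this

theorem max_natDegree_le_max_natDegree_sub_C_mul (p q : ℂ[X]) (c : ℂ) :
    max p.natDegree q.natDegree ≤ max (p - C c * q).natDegree q.natDegree := by
  have h1 : p.natDegree ≤ max (p - C c * q).natDegree (C c * q).natDegree := by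
    have := natDegree_add_le (p - C c * q) (C c * q)
    rwa [sub_add_cancel] at this
  have h2 := natDegree_C_mul_le c q
  omega

theorem isCoprime_sub_C_mul {p q : ℂ[X]} (hpq : IsCoprime p q) (c : ℂ) :
    IsCoprime (p - C c * q) q := by
  have := hpq.add_mul_left_left (-C c)
  rwa [mul_comm, neg_mul, ← sub_eq_add_neg] at this

theorem finite_zeros {p q : ℂ[X]} (hpq : IsCoprime p q)
    (hn : 2 ≤ max p.natDegree q.natDegree) (c : ℂ) : (zeros p q c).Finite :=
  (finite_eval_eq_conj_mul (isCoprime_sub_C_mul hpq c)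
    (hn.trans (max_natDegree_le_max_natDegree_sub_C_mul p q c))).subset fun _ hz => (mem_zeros_iff hpq).1 hz

/-- The index of a regular `f_c` is read off from its behaviour at infinity. -/
theorem Nplus_sub_Nminus_eq {p q : ℂ[X]} (hpq : IsCoprime p q)
    (hn : 2 ≤ max p.natDegree q.natDegree) {c : ℂ} (hreg : IsRegular p q c) {m n : ℕ} {κ : ℂ}
    (hκ : κ ≠ 0) (hinf : Tendsto (fun z => ((p - C c * q).eval z - conj z * q.eval z) /
      (z ^ m * conj z ^ n)) (cocompact ℂ) (𝓝 κ)) :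
    (Nplus p q c : ℤ) - Nminus p q c = m - n := by
  have hfin := finite_zeros hpq hn c
  have hP : (sensePreservingZeros p q c).Finite := hfin.subset fun _ hz => hz.1
  have hN : (senseReversingZeros p q c).Finite := hfin.subset fun _ hz => hz.1
  rw [Nplus, Nminus, Set.ncard_eq_toFinset_card _ hP, Set.ncard_eq_toFinset_card _ hN]
  have hfactor : ∀ s, q.eval s ≠ 0 → ∀ w : ℂ → ℂ,
      AvoidsZeroNear (fun z => (rShift p q c z - conj z) / w z) s →
      AvoidsZeroNear (fun z => ((p - C c * q).eval z - conj z * q.eval z) / w z) s := by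
    intro s hs w h
    refine (avoidsZeroNear_mul h q.continuous.continuousAt hs).congr ?_
    filter_upwards [nhdsWithin_le_nhds (q.continuous.continuousAt.eventually_ne hs)] with z hz
    rw [eval_sub_conj_mul_eq hz, div_mul_eq_mul_div]
  refine card_sub_card_eq (H := fun z => (p - C c * q).eval z - conj z * q.eval z)
    (by fun_prop) ?_ ?_ ?_ ?_ hκ hinf
  · rw [Set.Finite.disjoint_toFinset, Set.disjoint_left]
    exact fun z h1 h2 => h1.2.not_gt h2.2
  · intro z h1 h2 h
    have hz : z ∈ zeros p q c := (mem_zeros_iff hpq).2 (sub_eq_zero.1 h)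
    rw [Set.Finite.mem_toFinset] at h1 h2
    have h3 : z ∉ singularZeros p q c := by
      rw [show singularZeros p q c = ∅ from hreg]
      exact Set.notMem_empty z
    rcases lt_trichotomy ‖deriv (rShift p q c) z‖ 1 with h4 | h4 | h4
    · exact h2 ⟨hz, h4⟩
    · exact h3 ⟨hz, h4⟩
    · exact h1 ⟨hz, h4⟩
  · intro s hs
    obtain ⟨h1, h2⟩ := hP.mem_toFinset.1 hs
    exact hfactor s h1.1 _
      (avoidsZeroNear_sub_conj_div (hasDerivAt_rShift h1.1) (rShift_eq_conj h1) h2)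
  · intro s hs
    obtain ⟨h1, h2⟩ := hN.mem_toFinset.1 hs
    exact hfactor s h1.1 _
      (avoidsZeroNear_sub_conj_div_conj (hasDerivAt_rShift h1.1) (rShift_eq_conj h1) h2)

end RationalHarmonic

theorem mainTheorem4 (p q : ℂ[X]) (hpq : IsCoprime p q)
    (hn : 2 ≤ max p.natDegree q.natDegree) (c : ℂ)
    (hreg : RationalHarmonic.IsRegular p q c) :
    (RationalHarmonic.zeros p q c).Finite ∧
    (p.natDegree ≤ q.natDegree →
      (RationalHarmonic.Nplus p q c : ℤ) - (RationalHarmonic.Nminus p q c : ℤ)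
        = (q.natDegree : ℤ) - 1) ∧
    (q.natDegree + 1 < p.natDegree →
      (RationalHarmonic.Nplus p q c : ℤ) - (RationalHarmonic.Nminus p q c : ℤ)
        = (p.natDegree : ℤ)) := by
  refine ⟨RationalHarmonic.finite_zeros hpq hn c, fun h => ?_, fun h => ?_⟩
  · have hq : q ≠ 0 := by
      rintro rfl
      rw [natDegree_zero] at h hn
      omega
    have hdeg : (p - C c * q).natDegree ≤ q.natDegree :=
      (natDegree_sub_le _ _).trans (max_le h (natDegree_C_mul_le c q))
    have := RationalHarmonic.Nplus_sub_Nminus_eq hpq hn hreg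
      (neg_ne_zero.2 (leadingCoeff_ne_zero.2 hq))
      (RationalHarmonic.tendsto_numerator_of_natDegree_le hdeg)
    exact_mod_cast this
  · have hdeg : (p - C c * q).natDegree = p.natDegree :=
      natDegree_sub_eq_left_of_natDegree_lt ((natDegree_C_mul_le c q).trans_lt (by omega))
    have hp : p - C c * q ≠ 0 := by
      intro h0
      rw [h0, natDegree_zero] at hdeg
      omega
    have := RationalHarmonic.Nplus_sub_Nminus_eq hpq hn hreg (leadingCoeff_ne_zero.2 hp)
      (RationalHarmonic.tendsto_numerator_of_lt_natDegree (Q := q) (by omega))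
    rw [hdeg] at this
    simpa using this
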